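/- Let $G=(V,E,w)$ be a finite connected simple undirected graph with $n=|V|$ vertices and edge weights $w:E\to\mathbb{R}_{\ge 0}$. For $U\subseteq V$ let $\partial U$ be the set of edges with exactly one end in $U$; for $s\ne t$ an $s,t$-cut is a set $U$ with $s\in U$, $t\notin U$, and its weight is $|\partial U|=\sum_{e\in\partial U}w(e)$. The cutsets $\partial U$ form a vector space $\mathfrak{D}$ over $\mathrm{GF}(2)$ under symmetric difference. A cut $D\in\mathfrak{D}$ is *relevant* if it belongs to a basis $\mathcal{B}$ of $\mathfrak{D}$ for which $\sum_{B\in\mathcal{B}}|B|$ is minimum among all bases of $\mathfrak{D}$. A *Gomory–Hu tree* of $G$ is a tree $T^*=(V,F,\lambda)$ with edge weights $\lambda:F\to\mathbb{R}$ such that (G1) removing any $e\in F$ from $T^*$ induces a partition of $V$ into two nonempty sides; (G2) for every $e=ab\in F$, $\lambda_e$ is the minimum weight of an $a,b$-cut of $G$; (G3) for all $u\neq v$ in $V$, the minimum weight of a $u,v$-cut of $G$ equals the minimum of $\lambda_e$ over the edges $e$ of the path from $u$ to $v$ in $T^*$. (It is not required that the sides in (G1) be minimum cuts.) For $a\ne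 b$ in $V$ and a maximum $a,b$-flow $f$ in $G$ (each edge being usable in both directions with capacity its weight), the *Picard–Queyranne DAG* $D_{a,b}$ is obtained from the residual network of $f$ by contracting every strongly connected component to a single node. A set of nodes is *closed* if no edge of $D_{a,b}$ leaves it; a cut $D$ is *represented* by a closed set $C$ of $D_{a,b}$ if $D=\partial U$ for the set $U$ of all vertices in the nodes of $C$, where $a\in U$ and $b\notin U$. **Theorem.** Let $T^*=(V,F,\lambda)$ be any Gomory–Hu tree of $G$, and for each edge $e\in F$ choose an ordering $(a,b)$ of its two ends and a maximum $a,b$-flow, both arbitrarily, with resulting Picard–Queyranne DAG $D_{a,b}$. Then a cut $D\in\mathfrak{D}$ is relevant if and only if it is represented by a closed set in at least one of these DAGs $D_{a,b}$, $ab\in F$. Moreover $|F|=n-1$, so that these $n-1$ DAGs, one per tree edge, suffice to represent all relevant cuts. -/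

import Mathlib

noncomputable section

namespace RelevantCuts

variable {V : Type*}

/-! ### Cuts, the cut space and relevant cuts -/

/-- The edge `e` of `G` belongs to the cutset `∂U`: it has one end in `U` and one end outside. -/
def Crosses (G : SimpleGraph V) (U : Set V) (e : G.edgeSet) : Prop :=
  ∃ x ∈ U, ∃ y ∉ U, (e : Sym2 V) = s(x, y)

open Classical in
/-- The cutset `∂U`, as a vector over GF(2) indexed by the edges of `G`
(edge sets with symmetric difference are identified with their indicator vectors). -/
def cutset (G : SimpleGraph V) (U : Set V) : G.edgeSet → ZMod 2 :=
  fun e => if Crosses G U e then 1 else 0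

theorem cutset_empty (G : SimpleGraph V) : cutset G ∅ = 0 := by
  funext e
  simp [cutset, Crosses]

theorem cutset_symmDiff (G : SimpleGraph V) (U W : Set V) :
    cutset G (symmDiff U W) = cutset G U + cutset G W := by
  classical
  have key : ∀ (S : Set V) (a b : V) (h : s(a, b) ∈ G.edgeSet),
      cutset G S ⟨s(a, b), h⟩ = (if a ∈ S then 1 else 0) + (if b ∈ S then 1 else 0) := by
    intro S a b h
    have hc : Crosses G S ⟨s(a, b), h⟩ ↔ (a ∈ S ∧ b ∉ S) ∨ (b ∈ S ∧ a ∉ S) := by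
      constructor
      · rintro ⟨x, hx, y, hy, hxy⟩
        rcases Sym2.eq_iff.1 hxy with ⟨rfl, rfl⟩ | ⟨rfl, rfl⟩
        · exact Or.inl ⟨hx, hy⟩
        · exact Or.inr ⟨hx, hy⟩
      · rintro (⟨h1, h2⟩ | ⟨h1, h2⟩)
        · exact ⟨a, h1, b, h2, rfl⟩
        · exact ⟨b, h1, a, h2, Sym2.eq_swap⟩
    by_cases ha : a ∈ S <;> by_cases hb : b ∈ S <;> simp [cutset, hc, ha, hb] <;> decide
  funext ⟨e, he⟩
  induction e using Sym2.ind with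
  | _ a b =>
    rw [Pi.add_apply, key, key, key]
    by_cases h1 : a ∈ U <;> by_cases h2 : a ∈ W <;> by_cases h3 : b ∈ U <;>
      by_cases h4 : b ∈ W <;> simp [Set.mem_symmDiff, h1, h2, h3, h4] <;> decide

/-- The cut space of `G`: the GF(2)-vector space formed by all cutsets `∂U`
(`∂∅ = ∂V` being its zero vector). -/
def cutSpace (G : SimpleGraph V) : Submodule (ZMod 2) (G.edgeSet → ZMod 2) where
  carrier := {D | ∃ U : Set V, D = cutset G U}
  zero_mem' := ⟨∅, (cutset_empty G).symm⟩
  add_mem' := by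
    rintro _ _ ⟨U, rfl⟩ ⟨W, rfl⟩
    exact ⟨symmDiff U W, (cutset_symmDiff G U W).symm⟩
  smul_mem' := by
    rintro c _ ⟨U, rfl⟩
    have hc : c = 0 ∨ c = 1 := by revert c; decide
    rcases hc with rfl | rfl
    · exact ⟨∅, by rw [zero_smul, cutset_empty]⟩
    · exact ⟨U, by rw [one_smul]⟩

open Classical in
/-- The weight `|D|`: the sum of the weights of the edges in `D`. -/
def weight [Fintype V] (G : SimpleGraph V) (w : G.edgeSet → ℝ) (D : G.edgeSet → ZMod 2) : ℝ :=
  ∑ e : G.edgeSet, if D e = 1 then w e else 0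

/-- `B` is a basis of the cut space of `G`. -/
def IsCutBasis (G : SimpleGraph V) (B : Finset (G.edgeSet → ZMod 2)) : Prop :=
  LinearIndependent (ZMod 2) (fun D : B => (D : G.edgeSet → ZMod 2)) ∧
    Submodule.span (ZMod 2) (B : Set (G.edgeSet → ZMod 2)) = cutSpace G

/-- `B` is a basis of the cut space of minimum total weight. -/
def IsMinCutBasis [Fintype V] (G : SimpleGraph V) (w : G.edgeSet → ℝ)
    (B : Finset (G.edgeSet → ZMod 2)) : Prop :=
  IsCutBasis G B ∧
    ∀ B' : Finset (G.edgeSet → ZMod 2), IsCutBasis G B' →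
      ∑ D ∈ B, weight G w D ≤ ∑ D ∈ B', weight G w D

/-- `D` is relevant: it belongs to some minimum cut basis. -/
def IsRelevant [Fintype V] (G : SimpleGraph V) (w : G.edgeSet → ℝ)
    (D : G.edgeSet → ZMod 2) : Prop :=
  ∃ B : Finset (G.edgeSet → ZMod 2), IsMinCutBasis G w B ∧ D ∈ B

/-! ### Gomory–Hu trees -/

/-- `c` is the weight of a minimum `s,t`-cut of `G`. -/
def IsMinCutWeight [Fintype V] (G : SimpleGraph V) (w : G.edgeSet → ℝ) (s t : V) (c : ℝ) : Prop :=
  IsLeast {r : ℝ | ∃ U : Set V, s ∈ U ∧ t ∉ U ∧ r = weight G w (cutset G U)} c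

/-- The side of `a` in the bipartition obtained from the tree `T` by removing the edge `ab`. -/
def treeSide (T : SimpleGraph V) (a b : V) : Set V :=
  {x | (T.deleteEdges {s(a, b)}).Reachable a x}

/-- The tree `T` on the vertex set of `G`, with edge weights `lam`, is a Gomory–Hu tree of
`(G, w)`. The sides of the tree edges are not required to be minimum cuts themselves (a tree for
which they are, with `lam` as their weights, satisfies `edge_weight` and `path_weight`). -/
structure IsGomoryHuTree [Fintype V] (G : SimpleGraph V) (w : G.edgeSet → ℝ)
    (T : SimpleGraph V) (lam : T.edgeSet → ℝ) : Prop where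
  isTree : T.IsTree
  /-- removing a tree edge induces a bipartition of `V` into two nonempty sides -/
  edge_cut : ∀ a b : V, T.Adj a b →
    (treeSide T a b).Nonempty ∧ (treeSide T b a).Nonempty ∧
      treeSide T b a = (treeSide T a b)ᶜ
  /-- the weight of a tree edge is the weight of a minimum cut between its ends -/
  edge_weight : ∀ (a b : V) (h : T.Adj a b), IsMinCutWeight G w a b (lam ⟨s(a, b), h⟩)
  /-- the weight of a minimum `u,v`-cut is the minimum tree weight along the path from `u` to `v` -/
  path_weight : ∀ (u v : V), u ≠ v → ∀ p : T.Walk u v, p.IsPath →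
    ∃ c : ℝ, IsMinCutWeight G w u v c ∧
      IsLeast {r : ℝ | ∃ e : T.edgeSet, (e : Sym2 V) ∈ p.edges ∧ r = lam e} c

/-! ### Flows and Picard–Queyranne DAGs -/

open Classical in
/-- The capacity of the arc from `x` to `y`: the weight of the edge `xy`, and `0` if there is none
(an undirected edge is a pair of opposite arcs). -/
def capacity (G : SimpleGraph V) (w : G.edgeSet → ℝ) (x y : V) : ℝ :=
  if h : G.Adj x y then w ⟨s(x, y), h⟩ else 0

/-- `f` is a (net) `s,t`-flow: skew-symmetric, within the capacities, and conserved at every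
vertex other than `s` and `t`. -/
structure IsFlow [Fintype V] (G : SimpleGraph V) (w : G.edgeSet → ℝ) (s t : V)
    (f : V → V → ℝ) : Prop where
  skew : ∀ x y, f x y = -f y x
  le_capacity : ∀ x y, f x y ≤ capacity G w x y
  conserved : ∀ x, x ≠ s → x ≠ t → ∑ y, f x y = 0

/-- `f` is an `s,t`-flow of maximum value, the value being the net flow out of `s`. -/
def IsMaxFlow [Fintype V] (G : SimpleGraph V) (w : G.edgeSet → ℝ) (s t : V)
    (f : V → V → ℝ) : Prop :=
  IsFlow G w s t f ∧ ∀ g : V → V → ℝ, IsFlow G w s t g → ∑ y, g s y ≤ ∑ y, f s y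

/-- The residual network of `f`: an arc from `x` to `y` whenever more flow can be sent from `x`
to `y`. -/
def residual (G : SimpleGraph V) (w : G.edgeSet → ℝ) (f : V → V → ℝ) : Digraph V where
  Adj x y := f x y < capacity G w x y

/-- Two vertices lie in the same strongly connected component of the residual network. -/
def residualSetoid (G : SimpleGraph V) (w : G.edgeSet → ℝ) (f : V → V → ℝ) : Setoid V where
  r x y := Relation.ReflTransGen (residual G w f).Adj x y ∧
    Relation.ReflTransGen (residual G w f).Adj y x
  iseqv :=
    { refl := fun _ => ⟨.refl, .refl⟩
      symm := fun h => ⟨h.2, h.1⟩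
      trans := fun h k => ⟨h.1.trans k.1, k.2.trans h.2⟩ }

/-- The nodes of the Picard–Queyranne DAG: the strongly connected components of the residual
network. -/
abbrev PQNode (G : SimpleGraph V) (w : G.edgeSet → ℝ) (f : V → V → ℝ) : Type _ :=
  Quotient (residualSetoid G w f)

/-- The node of the Picard–Queyranne DAG that contains the vertex `x`. -/
def pqNode (G : SimpleGraph V) (w : G.edgeSet → ℝ) (f : V → V → ℝ) (x : V) : PQNode G w f :=
  Quotient.mk (residualSetoid G w f) x

/-- The Picard–Queyranne DAG of `(G, w)` built from the maximum `s,t`-flow `f`: the residual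
network with every strongly connected component contracted to a single node. -/
def pqDAG (G : SimpleGraph V) (w : G.edgeSet → ℝ) (f : V → V → ℝ) : Digraph (PQNode G w f) where
  Adj p q := p ≠ q ∧ ∃ x y, pqNode G w f x = p ∧ pqNode G w f y = q ∧ (residual G w f).Adj x y

/-- A node set is closed if no edge leaves it. -/
def IsClosedNodeSet {N : Type*} (H : Digraph N) (C : Set N) : Prop :=
  ∀ p ∈ C, ∀ q, H.Adj p q → q ∈ C

/-- The set of all vertices that belong to the nodes in `C`. -/
def nodeVertices (G : SimpleGraph V) (w : G.edgeSet → ℝ) (f : V → V → ℝ)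
    (C : Set (PQNode G w f)) : Set V :=
  {x | pqNode G w f x ∈ C}

/-- `D` is represented by a closed set of the Picard–Queyranne DAG `D_{s,t}` built from `f`:
`D = ∂U`, where `U` is the vertex set of a closed node set, with `s ∈ U` and `t ∉ U`. -/
def IsRepresented (G : SimpleGraph V) (w : G.edgeSet → ℝ) (s t : V) (f : V → V → ℝ)
    (D : G.edgeSet → ZMod 2) : Prop :=
  ∃ C : Set (PQNode G w f), IsClosedNodeSet (pqDAG G w f) C ∧
    s ∈ nodeVertices G w f C ∧ t ∉ nodeVertices G w f C ∧
    D = cutset G (nodeVertices G w f C)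

end RelevantCuts

end

/-!
The relevant cuts are the cuts that are minimum `a,b`-cuts for the ends `a`, `b` of some tree edge,
and these are the cuts represented by the Picard–Queyranne DAG `D_{a,b}`.

*Closed sets and minimum cuts* (`isRepresented_iff`). The value of a flow equals the weight of a
separating cut exactly when no residual arc leaves the cut. So a closed set gives a minimum cut.
Conversely the value of a maximum flow is attained by some cut, as there is no augmenting walk, so
every minimum cut has that weight and is closed. Reversing the pair `a`, `b` complements the vertex
set and leaves the cutset unchanged, hence the orientation of a tree edge does not matter.

*Minimum cuts are relevant* (`isRelevant_of_isMinCutWeight`). The cutsets that do not separate `a`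
from `b` form a proper subspace which misses a minimum `a,b`-cut `D`. Hence in the expansion of `D`
in a minimum basis some member separates `a` from `b`; it is at least as heavy as `D`, and
exchanging it for `D` gives a minimum basis containing `D`.

*Relevant cuts are minimum cuts of tree edges* (`IsGomoryHuTree.exists_edge_of_isRelevant`). By
exchange, a relevant cut `D = ∂U` is not a sum of cuts lighter than `c = |D|`. Suppose every tree
edge crossing `U` had weight less than `c`. For `x ∈ U` and `y ∉ U` the tree path from `x` to `y`
crosses `U`, so some cut of weight less than `c` separates `x` from `y`. By `cutset_mem_lightSpan`
this makes `∂U` a sum of cuts of weight less than `c`. That lemma is the heart of the proof: the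
sides of a Gomory–Hu tree need not be minimum cuts, so the light cuts are found by uncrossing
instead. With `x` fixed, the inclusion-minimal minimum cuts separating `x` from the other vertices
form a laminar family (`IsMinimalMinCut.laminar`); the maximal light ones partition the complement
of the class of vertices that light cuts do not separate from `x`, and `U` is a disjoint union of
such classes.
-/

namespace RelevantCuts

open Classical Finset

/-! ### Cut weights -/

theorem cutset_eq_one_iff {V : Type*} (G : SimpleGraph V) (U : Set V) (e : G.edgeSet) :
    cutset G U e = 1 ↔ Crosses G U e := by
  by_cases h : Crosses G U e <;> simp [cutset, h]

theorem crosses_mk_iff {V : Type*} {G : SimpleGraph V} {U : Set V} {a b : V}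
    (h : s(a, b) ∈ G.edgeSet) :
    Crosses G U ⟨s(a, b), h⟩ ↔ (a ∈ U ∧ b ∉ U) ∨ (b ∈ U ∧ a ∉ U) := by
  constructor
  · rintro ⟨x, hx, y, hy, hxy⟩
    rcases Sym2.eq_iff.1 hxy with ⟨rfl, rfl⟩ | ⟨rfl, rfl⟩
    · exact Or.inl ⟨hx, hy⟩
    · exact Or.inr ⟨hx, hy⟩
  · rintro (⟨h1, h2⟩ | ⟨h1, h2⟩)
    · exact ⟨a, h1, b, h2, rfl⟩
    · exact ⟨b, h1, a, h2, Sym2.eq_swap⟩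

theorem cutset_compl {V : Type*} (G : SimpleGraph V) (U : Set V) :
    cutset G Uᶜ = cutset G U := by
  funext ⟨e, he⟩
  induction e using Sym2.ind with
  | _ a b =>
    have : Crosses G Uᶜ ⟨s(a, b), he⟩ ↔ Crosses G U ⟨s(a, b), he⟩ := by
      rw [crosses_mk_iff, crosses_mk_iff]
      simp only [Set.mem_compl_iff]
      tauto
    simp only [cutset, this]

theorem cutset_union_of_disjoint {V : Type*} (G : SimpleGraph V) {U W : Set V}
    (h : Disjoint U W) : cutset G (U ∪ W) = cutset G U + cutset G W := by
  rw [← cutset_symmDiff, h.symmDiff_eq_sup]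
  rfl

theorem weight_cutset {V : Type*} [Fintype V] (G : SimpleGraph V) (w : G.edgeSet → ℝ)
    (U : Set V) :
    weight G w (cutset G U) = ∑ e : G.edgeSet, if Crosses G U e then w e else 0 := by
  simp only [weight, cutset_eq_one_iff]

theorem weight_cutset_inter_add_union_le {V : Type*} [Fintype V] (G : SimpleGraph V)
    {w : G.edgeSet → ℝ} (hw : ∀ e, 0 ≤ w e) (A B : Set V) :
    weight G w (cutset G (A ∩ B)) + weight G w (cutset G (A ∪ B)) ≤
      weight G w (cutset G A) + weight G w (cutset G B) := by
  simp only [weight_cutset, ← Finset.sum_add_distrib]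
  refine Finset.sum_le_sum ?_
  rintro ⟨e, he⟩ -
  induction e using Sym2.ind with
  | _ a b =>
    have h0 := hw ⟨s(a, b), he⟩
    simp only [crosses_mk_iff, Set.mem_inter_iff, Set.mem_union]
    by_cases h1 : a ∈ A <;> by_cases h2 : a ∈ B <;> by_cases h3 : b ∈ A <;>
      by_cases h4 : b ∈ B <;> simp [h1, h2, h3, h4, h0]

theorem weight_cutset_sdiff_add_sdiff_le {V : Type*} [Fintype V] (G : SimpleGraph V)
    {w : G.edgeSet → ℝ} (hw : ∀ e, 0 ≤ w e) (A B : Set V) :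
    weight G w (cutset G (A \ B)) + weight G w (cutset G (B \ A)) ≤
      weight G w (cutset G A) + weight G w (cutset G B) := by
  have h := weight_cutset_inter_add_union_le G hw A Bᶜ
  have h1 : (B \ A)ᶜ = A ∪ Bᶜ := by
    ext x
    simp only [Set.mem_compl_iff, Set.mem_sdiff, Set.mem_union]
    tauto
  rwa [← h1, cutset_compl, cutset_compl, ← Set.sdiff_eq] at h

theorem weight_cutset_eq_sum_capacity {V : Type*} [Fintype V] (G : SimpleGraph V)
    (w : G.edgeSet → ℝ) (U : Set V) :
    weight G w (cutset G U) =
      ∑ x with x ∈ U, ∑ y with y ∉ U, capacity G w x y := by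
  rw [weight_cutset, ← Finset.sum_filter, ← Finset.sum_product']
  have h : ∑ p ∈ (univ.filter (· ∈ U)) ×ˢ (univ.filter (· ∉ U)), capacity G w p.1 p.2 =
      ∑ p ∈ ((univ.filter (· ∈ U)) ×ˢ (univ.filter (· ∉ U))).filter
        (fun p : V × V => G.Adj p.1 p.2), capacity G w p.1 p.2 := by
    rw [Finset.sum_filter]
    refine Finset.sum_congr rfl fun p _ => ?_
    by_cases hp : G.Adj p.1 p.2 <;> simp [capacity, hp]
  rw [h]
  symm
  refine Finset.sum_bij (fun p hp => ⟨s(p.1, p.2), (Finset.mem_filter.1 hp).2⟩) ?_ ?_ ?_ ?_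
  · rintro ⟨x, y⟩ hp
    simp only [mem_filter, mem_product, mem_univ, true_and] at hp ⊢
    exact ⟨x, hp.1.1, y, hp.1.2, rfl⟩
  · rintro ⟨x, y⟩ hp ⟨x', y'⟩ hp' h
    simp only [mem_filter, mem_product, mem_univ, true_and] at hp hp'
    rcases Sym2.eq_iff.1 (congrArg Subtype.val h) with ⟨h1, h2⟩ | ⟨h1, h2⟩
    · exact Prod.ext h1 h2
    · simp only at h1 h2
      exact absurd (h1 ▸ hp.1.1) hp'.1.2
  · rintro ⟨e, he⟩ hc
    simp only [mem_filter, mem_univ, true_and] at hc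
    obtain ⟨x, hx, y, hy, hxy⟩ := hc
    simp only at hxy
    subst hxy
    exact ⟨(x, y), by simpa [hx, hy] using he, rfl⟩
  · rintro ⟨x, y⟩ hp
    have : G.Adj x y := (mem_filter.1 hp).2
    simp [capacity, this]

/-! ### Maximum flows and closed sets of the residual network -/

/-- The value of a flow is its net amount across any cut separating source and sink. -/
theorem IsFlow.sum_cut {V : Type*} [Fintype V] {G : SimpleGraph V} {w : G.edgeSet → ℝ}
    {s t : V} {f : V → V → ℝ} (hf : IsFlow G w s t f) {U : Set V} (hs : s ∈ U) (ht : t ∉ U) :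
    ∑ x with x ∈ U, ∑ y with y ∉ U, f x y = ∑ y, f s y := by
  have h1 : ∑ x with x ∈ U, ∑ y, f x y = ∑ y, f s y := by
    refine Finset.sum_eq_single_of_mem s (by simpa using hs) fun x hx hxs => ?_
    refine hf.conserved x hxs ?_
    rintro rfl
    exact ht (by simpa using hx)
  have h2 : ∑ x with x ∈ U, ∑ y with y ∈ U, f x y = 0 := by
    have h3 : ∑ x with x ∈ U, ∑ y with y ∈ U, f x y =
        -∑ x with x ∈ U, ∑ y with y ∈ U, f x y := by
      conv_lhs => rw [Finset.sum_comm]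
      simp only [← Finset.sum_neg_distrib]
      exact Finset.sum_congr rfl fun x _ => Finset.sum_congr rfl fun y _ => hf.skew y x
    linarith
  have h4 : ∑ x with x ∈ U, ∑ y, f x y = ∑ x with x ∈ U, ∑ y with y ∈ U, f x y +
      ∑ x with x ∈ U, ∑ y with y ∉ U, f x y := by
    rw [← Finset.sum_add_distrib]
    exact Finset.sum_congr rfl fun x _ => (Finset.sum_filter_add_sum_filter_not _ _ _).symm
  linarith

theorem IsFlow.value_le_weight {V : Type*} [Fintype V] {G : SimpleGraph V} {w : G.edgeSet → ℝ}
    {s t : V} {f : V → V → ℝ} (hf : IsFlow G w s t f) {U : Set V} (hs : s ∈ U) (ht : t ∉ U) :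
    ∑ y, f s y ≤ weight G w (cutset G U) := by
  rw [← hf.sum_cut hs ht, weight_cutset_eq_sum_capacity]
  exact Finset.sum_le_sum fun x _ => Finset.sum_le_sum fun y _ => hf.le_capacity x y

/-- A cut is as light as the flow value exactly when no residual arc leaves it. -/
theorem IsFlow.value_eq_weight_iff {V : Type*} [Fintype V] {G : SimpleGraph V}
    {w : G.edgeSet → ℝ} {s t : V} {f : V → V → ℝ} (hf : IsFlow G w s t f) {U : Set V}
    (hs : s ∈ U) (ht : t ∉ U) :
    ∑ y, f s y = weight G w (cutset G U) ↔
      ∀ x ∈ U, ∀ y, (residual G w f).Adj x y → y ∈ U := by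
  rw [← hf.sum_cut hs ht, weight_cutset_eq_sum_capacity,
    Finset.sum_eq_sum_iff_of_le
      fun x _ => Finset.sum_le_sum fun y _ => hf.le_capacity x y]
  refine forall_congr' fun x => ?_
  rw [Finset.sum_eq_sum_iff_of_le fun y _ => hf.le_capacity x y]
  simp only [mem_filter, mem_univ, true_and, residual]
  refine imp_congr_right fun _ => forall_congr' fun y => ?_
  rw [lt_iff_le_and_ne]
  have := hf.le_capacity x y
  tauto

/-- If `x` can be reached from `s` along arcs of `r`, then a unit of skew-symmetric flow from `s` to
`x` is positive on arcs of `r` only. It is built by adding one arc at a time, so the walk need not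
be a path. -/
theorem exists_unit_flow_of_reachable {V : Type*} [Fintype V] (r : V → V → Prop) {s x : V}
    (h : Relation.ReflTransGen r s x) :
    ∃ g : V → V → ℝ, (∀ y z, g y z = -g z y) ∧ (∀ y z, 0 < g y z → r y z) ∧
      ∀ y, ∑ z, g y z = (if y = s then 1 else 0) - (if y = x then 1 else 0) := by
  induction h with
  | refl => exact ⟨0, by simp, by simp, by simp⟩
  | @tail x x' _ hr ih =>
    obtain ⟨g, hskew, hpos, hsum⟩ := ih
    refine ⟨fun y z => g y z + ((if y = x ∧ z = x' then 1 else 0) -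
      (if y = x' ∧ z = x then 1 else 0)), fun y z => ?_, fun y z hyz => ?_, fun y => ?_⟩
    · simp only [hskew y z, and_comm (a := z = x), and_comm (a := z = x')]
      ring
    · by_cases h1 : y = x ∧ z = x'
      · rw [h1.1, h1.2]
        exact hr
      · refine hpos y z ?_
        simp only [h1, if_false] at hyz
        split_ifs at hyz <;> linarith
    · rw [Finset.sum_add_distrib, hsum, Finset.sum_sub_distrib]
      have h1 : ∀ a b : V, ∑ z, (if y = a ∧ z = b then (1 : ℝ) else 0) =
          if y = a then 1 else 0 := by
        intro a b
        by_cases h : y = a <;> simp [h]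
      rw [h1, h1]
      ring

/-- A residual walk from source to sink would allow the flow to be augmented. -/
theorem IsMaxFlow.not_reachable {V : Type*} [Fintype V] {G : SimpleGraph V}
    {w : G.edgeSet → ℝ} {s t : V} {f : V → V → ℝ} (hf : IsMaxFlow G w s t f) (hst : s ≠ t) :
    ¬ Relation.ReflTransGen (residual G w f).Adj s t := by
  intro h
  obtain ⟨g, hskew, hpos, hsum⟩ := exists_unit_flow_of_reachable _ h
  -- A small positive multiple of `g` added to `f` is still within the capacities: `g` is positive
  -- only where `f` leaves slack.
  have hev : ∀ᶠ ε : ℝ in nhdsWithin 0 (Set.Ioi 0),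
      ∀ x y, f x y + ε * g x y ≤ capacity G w x y := by
    refine Filter.eventually_all.2 fun x => Filter.eventually_all.2 fun y => ?_
    by_cases hg : 0 < g x y
    · have hlt : f x y + 0 * g x y < capacity G w x y := by
        rw [zero_mul, add_zero]
        exact hpos x y hg
      have hc : Continuous fun ε : ℝ => f x y + ε * g x y := by fun_prop
      exact ((hc.tendsto 0).eventually_le_const hlt).filter_mono nhdsWithin_le_nhds
    · filter_upwards [self_mem_nhdsWithin] with ε hε
      have := mul_nonneg (le_of_lt hε) (sub_nonneg.2 (not_lt.1 hg))
      have := hf.1.le_capacity x y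
      linarith
  obtain ⟨ε, hε, hpos'⟩ := (hev.and self_mem_nhdsWithin).exists
  have hsum' : ∀ x, ∑ y, (f x y + ε * g x y) =
      ∑ y, f x y + ε * ((if x = s then 1 else 0) - (if x = t then 1 else 0)) := fun x => by
    rw [Finset.sum_add_distrib, ← Finset.mul_sum, hsum]
  have hflow : IsFlow G w s t fun x y => f x y + ε * g x y := by
    refine ⟨fun x y => ?_, hε, fun x hxs hxt => ?_⟩
    · rw [hf.1.skew x y, hskew x y]
      ring
    · rw [hsum', hf.1.conserved x hxs hxt]
      simp [hxs, hxt]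
  have h1 := hf.2 _ hflow
  rw [hsum'] at h1
  simp only [if_true, if_neg hst] at h1
  have : 0 < ε := hpos'
  linarith

/-- Max-flow min-cut: the value of a maximum flow is attained by the cut of all vertices that
the residual network reaches from the source. -/
theorem IsMaxFlow.exists_weight_eq {V : Type*} [Fintype V] {G : SimpleGraph V}
    {w : G.edgeSet → ℝ} {s t : V} {f : V → V → ℝ} (hf : IsMaxFlow G w s t f) (hst : s ≠ t) :
    ∃ U : Set V, s ∈ U ∧ t ∉ U ∧ ∑ y, f s y = weight G w (cutset G U) := by
  have hs : s ∈ {x | Relation.ReflTransGen (residual G w f).Adj s x} := .refl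
  exact ⟨_, hs, hf.not_reachable hst,
    (hf.1.value_eq_weight_iff hs (hf.not_reachable hst)).2 fun _ hx _ hxy => hx.tail hxy⟩

/-- Picard–Queyranne: the closed node sets with `s` inside and `t` outside represent exactly the
minimum `s,t`-cuts. -/
theorem isRepresented_iff {V : Type*} [Fintype V] {G : SimpleGraph V}
    {w : G.edgeSet → ℝ} {s t : V} {f : V → V → ℝ} (hf : IsMaxFlow G w s t f) (hst : s ≠ t)
    (D : G.edgeSet → ZMod 2) :
    IsRepresented G w s t f D ↔
      ∃ U : Set V, D = cutset G U ∧ s ∈ U ∧ t ∉ U ∧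
        IsMinCutWeight G w s t (weight G w (cutset G U)) := by
  constructor
  · rintro ⟨C, hC, hs, ht, rfl⟩
    refine ⟨_, rfl, hs, ht, ⟨_, hs, ht, rfl⟩, ?_⟩
    rintro _ ⟨W, hsW, htW, rfl⟩
    rw [← (hf.1.value_eq_weight_iff hs ht).2]
    · exact hf.1.value_le_weight hsW htW
    · intro x hx y hxy
      by_cases h : pqNode G w f x = pqNode G w f y
      · change pqNode G w f y ∈ C
        rw [← h]
        exact hx
      · exact hC _ hx _ ⟨h, x, y, rfl, rfl, hxy⟩
  · rintro ⟨U, rfl, hs, ht, hmin⟩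
    obtain ⟨R, hsR, htR, hR⟩ := hf.exists_weight_eq hst
    have hclosed := (hf.1.value_eq_weight_iff hs ht).1
      (le_antisymm (hf.1.value_le_weight hs ht) (hR ▸ hmin.2 ⟨R, hsR, htR, rfl⟩))
    have hreach : ∀ x y, Relation.ReflTransGen (residual G w f).Adj x y → x ∈ U → y ∈ U := by
      intro x y h hx
      induction h with
      | refl => exact hx
      | tail _ h ih => exact hclosed _ ih _ h
    have hU : nodeVertices G w f (pqNode G w f '' U) = U := by
      ext x
      constructor
      · rintro ⟨y, hy, hyx⟩
        exact hreach y x (Quotient.exact hyx).1 hy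
      · exact fun hx => ⟨x, hx, rfl⟩
    refine ⟨pqNode G w f '' U, ?_, by rwa [hU], by rwa [hU], by rw [hU]⟩
    rintro p hp q ⟨-, x, y, rfl, rfl, hxy⟩
    have hx : x ∈ U := hU ▸ hp
    exact ⟨y, hclosed x hx y hxy, rfl⟩

/-! ### The span of the light cuts -/

/-- The subspace spanned by the cutsets of weight less than `c`. -/
def lightSpan {V : Type*} [Fintype V] (G : SimpleGraph V) (w : G.edgeSet → ℝ) (c : ℝ) :
    Submodule (ZMod 2) (G.edgeSet → ZMod 2) :=
  Submodule.span (ZMod 2) {D | ∃ U : Set V, D = cutset G U ∧ weight G w (cutset G U) < c}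

/-- A union of a laminar family is a disjoint union of its maximal members, so its cutset is the
sum of their cutsets. -/
theorem cutset_biUnion_mem_of_laminar {V ι : Type*} (G : SimpleGraph V)
    (S : Submodule (ZMod 2) (G.edgeSet → ZMod 2)) (X : ι → Set V) (I : Finset ι)
    (hX : ∀ i ∈ I, cutset G (X i) ∈ S)
    (hlam : ∀ i ∈ I, ∀ j ∈ I, X i ⊆ X j ∨ X j ⊆ X i ∨ Disjoint (X i) (X j)) :
    cutset G (⋃ i ∈ I, X i) ∈ S := by
  induction I using Finset.strongInduction with
  | H I ih =>
    have hsub : ∀ J ⊂ I, cutset G (⋃ i ∈ J, X i) ∈ S := fun J hJ =>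
      ih J hJ (fun i hi => hX i (hJ.1 hi)) fun i hi j hj => hlam i (hJ.1 hi) j (hJ.1 hj)
    rcases I.eq_empty_or_nonempty with rfl | ⟨i, hi⟩
    · simp [cutset_empty, S.zero_mem]
    by_cases hmax : ∃ j ∈ I, j ≠ i ∧ X i ⊆ X j
    · obtain ⟨j, hj, hji, hij⟩ := hmax
      have hU : ⋃ k ∈ I, X k = ⋃ k ∈ I.erase i, X k := by
        ext x
        simp only [Set.mem_iUnion, mem_erase, exists_prop]
        constructor
        · rintro ⟨k, hk, hx⟩
          by_cases hki : k = i
          · exact ⟨j, ⟨hji, hj⟩, hij (hki ▸ hx)⟩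
          · exact ⟨k, ⟨hki, hk⟩, hx⟩
        · rintro ⟨k, ⟨-, hk⟩, hx⟩
          exact ⟨k, hk, hx⟩
      rw [hU]
      exact hsub _ (erase_ssubset hi)
    · push Not at hmax
      -- `X i` is a maximal member: split off the members disjoint from it.
      set J := (I.erase i).filter fun j => Disjoint (X i) (X j) with hJ
      have hU : ⋃ k ∈ I, X k = X i ∪ ⋃ k ∈ J, X k := by
        ext x
        simp only [Set.mem_iUnion, Set.mem_union, hJ, mem_filter, mem_erase, exists_prop]
        constructor
        · rintro ⟨k, hk, hx⟩
          by_cases hki : k = i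
          · exact Or.inl (hki ▸ hx)
          rcases hlam i hi k hk with h | h | h
          · exact absurd h (hmax k hk hki)
          · exact Or.inl (h hx)
          · exact Or.inr ⟨k, ⟨⟨hki, hk⟩, h⟩, hx⟩
        · rintro (hx | ⟨k, ⟨⟨-, hk⟩, -⟩, hx⟩)
          · exact ⟨i, hi, hx⟩
          · exact ⟨k, hk, hx⟩
      have hdisj : Disjoint (X i) (⋃ k ∈ J, X k) :=
        Set.disjoint_iUnion₂_right.2 fun k hk => (mem_filter.1 hk).2
      rw [hU, cutset_union_of_disjoint G hdisj]
      exact S.add_mem (hX i hi) (hsub J ((filter_subset _ _).trans_ssubset (erase_ssubset hi)))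

/-- `X` is a minimum cut having `y` inside and `x` outside, and no proper subset of `X` is one. -/
structure IsMinimalMinCut {V : Type*} [Fintype V] (G : SimpleGraph V) (w : G.edgeSet → ℝ)
    (x y : V) (X : Set V) : Prop where
  mem : y ∈ X
  notMem : x ∉ X
  weight_le : ∀ Z : Set V, y ∈ Z → x ∉ Z → weight G w (cutset G X) ≤ weight G w (cutset G Z)
  subset : ∀ Z : Set V, Z ⊆ X → y ∈ Z → x ∉ Z →
    weight G w (cutset G Z) ≤ weight G w (cutset G X) → X ⊆ Z

theorem exists_isMinimalMinCut {V : Type*} [Fintype V] (G : SimpleGraph V) (w : G.edgeSet → ℝ)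
    {x y : V} (h : x ≠ y) : ∃ X : Set V, IsMinimalMinCut G w x y X := by
  obtain ⟨X, ⟨hy, hx⟩, hX⟩ := Set.exists_min_image {Z : Set V | y ∈ Z ∧ x ∉ Z}
    (fun Z => toLex (weight G w (cutset G Z), Z.ncard)) (Set.toFinite _) ⟨{y}, rfl, h⟩
  -- `X` minimizes the weight first and the number of vertices second.
  refine ⟨X, hy, hx, fun Z hyZ hxZ => ?_, fun Z hZX hyZ hxZ hw => ?_⟩
  · rcases Prod.Lex.toLex_le_toLex.1 (hX Z ⟨hyZ, hxZ⟩) with h | h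
    · exact h.le
    · exact h.1.le
  · rcases Prod.Lex.toLex_le_toLex.1 (hX Z ⟨hyZ, hxZ⟩) with h | h
    · exact absurd hw (not_le.2 h)
    · exact (Set.eq_of_subset_of_ncard_le hZX h.2).ge

/-- Uncrossing: the inclusion-minimal minimum cuts with a common outside vertex form a laminar
family. -/
theorem IsMinimalMinCut.laminar {V : Type*} [Fintype V] {G : SimpleGraph V} {w : G.edgeSet → ℝ}
    (hw : ∀ e, 0 ≤ w e) {x y z : V} {A B : Set V} (hA : IsMinimalMinCut G w x y A)
    (hB : IsMinimalMinCut G w x z B) : A ⊆ B ∨ B ⊆ A ∨ Disjoint A B := by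
  have hsub := weight_cutset_inter_add_union_le G hw A B
  have hUx : x ∉ A ∪ B := by simp [hA.notMem, hB.notMem]
  -- If one set contains the other's distinguished vertex, submodularity makes their intersection a
  -- minimum cut; otherwise posimodularity makes their differences minimum cuts.
  by_cases hzA : z ∈ A
  · have := hA.weight_le (A ∪ B) (Or.inl hA.mem) hUx
    exact Or.inr (Or.inl ((hB.subset (A ∩ B) Set.inter_subset_right ⟨hzA, hB.mem⟩
      (fun h => hA.notMem h.1) (by linarith)).trans Set.inter_subset_left))
  by_cases hyB : y ∈ B
  · have := hB.weight_le (A ∪ B) (Or.inr hB.mem) hUx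
    exact Or.inl ((hA.subset (A ∩ B) Set.inter_subset_left ⟨hA.mem, hyB⟩
      (fun h => hA.notMem h.1) (by linarith)).trans Set.inter_subset_right)
  · have h1 := weight_cutset_sdiff_add_sdiff_le G hw A B
    have h2 := hB.weight_le (B \ A) ⟨hB.mem, hzA⟩ fun h => hB.notMem h.1
    have h3 := hA.subset (A \ B) Set.sdiff_subset ⟨hA.mem, hyB⟩ (fun h => hA.notMem h.1)
      (by linarith)
    exact Or.inr (Or.inr (Set.disjoint_left.2 fun v hv => (h3 hv).2))

/-- The vertices that no cut of weight less than `c` separates from `x`. -/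
def lightClass {V : Type*} [Fintype V] (G : SimpleGraph V) (w : G.edgeSet → ℝ) (c : ℝ)
    (x : V) : Set V :=
  {y | ∀ W : Set V, weight G w (cutset G W) < c → (x ∈ W ↔ y ∈ W)}

/-- The complement of a class is the union of the minimal minimum cuts that separate its points
from the class. These cuts are light and laminar. -/
theorem cutset_lightClass_mem {V : Type*} [Fintype V] (G : SimpleGraph V) {w : G.edgeSet → ℝ}
    (hw : ∀ e, 0 ≤ w e) (c : ℝ) (x : V) :
    cutset G (lightClass G w c x) ∈ lightSpan G w c := by
  have hex : ∀ y, ∃ X : Set V, x ≠ y → IsMinimalMinCut G w x y X := fun y => by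
    by_cases h : x = y
    · exact ⟨∅, fun h' => absurd h h'⟩
    · exact (exists_isMinimalMinCut G w h).imp fun _ hX _ => hX
  choose X hX using hex
  have hne : ∀ y ∉ lightClass G w c x, x ≠ y := by
    rintro y hy rfl
    exact hy fun _ _ => Iff.rfl
  have hlight : ∀ y ∉ lightClass G w c x, weight G w (cutset G (X y)) < c := by
    intro y hy
    have hm := hX y (hne y hy)
    simp only [lightClass, Set.mem_ofPred_eq, not_forall] at hy
    obtain ⟨W, hW, hsep⟩ := hy
    by_cases hyW : y ∈ W
    · exact (hm.weight_le W hyW (by tauto)).trans_lt hW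
    · refine (hm.weight_le Wᶜ hyW ?_).trans_lt (by rwa [cutset_compl])
      simp only [Set.mem_compl_iff]
      tauto
  have hU : (lightClass G w c x)ᶜ = ⋃ y ∈ univ.filter (· ∉ lightClass G w c x), X y := by
    ext v
    simp only [Set.mem_compl_iff, Set.mem_iUnion, mem_filter, mem_univ, true_and, exists_prop]
    constructor
    · exact fun hv => ⟨v, hv, (hX v (hne v hv)).mem⟩
    · rintro ⟨y, hy, hvy⟩ hv
      exact (hX y (hne y hy)).notMem ((hv (X y) (hlight y hy)).2 hvy)
  rw [← cutset_compl, hU]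
  refine cutset_biUnion_mem_of_laminar G _ X _ (fun y hy => ?_) fun y hy z hz => ?_
  · exact Submodule.subset_span ⟨X y, rfl, hlight y (mem_filter.1 hy).2⟩
  · exact (hX y (hne y (mem_filter.1 hy).2)).laminar hw (hX z (hne z (mem_filter.1 hz).2))

/-- A cut all of whose separated pairs are separated by light cuts is a sum of light cuts. -/
theorem cutset_mem_lightSpan {V : Type*} [Fintype V] (G : SimpleGraph V) {w : G.edgeSet → ℝ}
    (hw : ∀ e, 0 ≤ w e) {c : ℝ} {U : Set V}
    (h : ∀ x ∈ U, ∀ y ∉ U, ∃ W : Set V, x ∈ W ∧ y ∉ W ∧ weight G w (cutset G W) < c) :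
    cutset G U ∈ lightSpan G w c := by
  have hU : U = ⋃ x ∈ univ.filter (· ∈ U), lightClass G w c x := by
    ext v
    simp only [Set.mem_iUnion, mem_filter, mem_univ, true_and, exists_prop]
    constructor
    · exact fun hv => ⟨v, hv, fun _ _ => Iff.rfl⟩
    · rintro ⟨x, hx, hv⟩
      by_contra hvU
      obtain ⟨W, hxW, hvW, hW⟩ := h x hx v hvU
      exact hvW ((hv W hW).1 hxW)
  rw [hU]
  refine cutset_biUnion_mem_of_laminar G _ _ _
    (fun x _ => cutset_lightClass_mem G hw c x) fun x _ y _ => ?_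
  by_cases hd : Disjoint (lightClass G w c x) (lightClass G w c y)
  · exact Or.inr (Or.inr hd)
  · obtain ⟨v, hvx, hvy⟩ := Set.not_disjoint_iff.1 hd
    exact Or.inl fun u hu W hW => by rw [← hu W hW, hvx W hW, hvy W hW]

/-! ### Minimum cut bases -/

theorem cutset_mem_cutSpace {V : Type*} (G : SimpleGraph V) (U : Set V) :
    cutset G U ∈ cutSpace G := ⟨U, rfl⟩

theorem isCutBasis_iff {V : Type*} {G : SimpleGraph V} {B : Finset (G.edgeSet → ZMod 2)} :
    IsCutBasis G B ↔ LinearIndepOn (ZMod 2) id (B : Set (G.edgeSet → ZMod 2)) ∧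
      Submodule.span (ZMod 2) (B : Set (G.edgeSet → ZMod 2)) = cutSpace G := Iff.rfl

theorem IsCutBasis.notMem_span_erase {V : Type*} {G : SimpleGraph V}
    [DecidableEq (G.edgeSet → ZMod 2)] {B : Finset (G.edgeSet → ZMod 2)} (hB : IsCutBasis G B)
    {b : G.edgeSet → ZMod 2} (hb : b ∈ B) :
    b ∉ Submodule.span (ZMod 2) (B.erase b : Set (G.edgeSet → ZMod 2)) := by
  have h := (isCutBasis_iff.1 hB).1
  rw [← insert_erase hb, coe_insert] at h
  simpa using h.notMem_span_of_insert (by simp)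

theorem IsCutBasis.exchange {V : Type*} {G : SimpleGraph V} [DecidableEq (G.edgeSet → ZMod 2)]
    {B : Finset (G.edgeSet → ZMod 2)} (hB : IsCutBasis G B) {b D : G.edgeSet → ZMod 2}
    (hb : b ∈ B) (hD : D ∈ cutSpace G)
    (hDb : D ∉ Submodule.span (ZMod 2) (B.erase b : Set (G.edgeSet → ZMod 2))) :
    IsCutBasis G (insert D (B.erase b)) := by
  have hBb : insert b (B.erase b : Set (G.edgeSet → ZMod 2)) = B := by
    rw [← coe_insert, insert_erase hb]
  rw [isCutBasis_iff]
  constructor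
  · rw [coe_insert]
    exact ((isCutBasis_iff.1 hB).1.mono (coe_subset.2 (erase_subset _ _))).id_insert hDb
  · rw [coe_insert]
    refine le_antisymm (Submodule.span_le.2 ?_) ?_
    · rintro v (rfl | hv)
      · exact hD
      · rw [← hB.2]
        exact Submodule.subset_span (mem_of_mem_erase (mem_coe.1 hv))
    · rw [← hB.2, ← hBb]
      refine Submodule.span_le.2 (Set.insert_subset ?_ fun v hv =>
        Submodule.subset_span (Or.inr hv))
      refine mem_span_insert_exchange ?_ hDb
      rwa [hBb, hB.2]

theorem sum_weight_exchange {V : Type*} [Fintype V] {G : SimpleGraph V} (w : G.edgeSet → ℝ)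
    [DecidableEq (G.edgeSet → ZMod 2)] {B : Finset (G.edgeSet → ZMod 2)}
    {b D : G.edgeSet → ZMod 2} (hb : b ∈ B)
    (hDb : D ∉ Submodule.span (ZMod 2) (B.erase b : Set (G.edgeSet → ZMod 2))) :
    ∑ v ∈ insert D (B.erase b), weight G w v + weight G w b =
      ∑ v ∈ B, weight G w v + weight G w D := by
  rw [sum_insert fun h => hDb (Submodule.subset_span h), ← add_sum_erase B _ hb]
  ring

theorem exists_isMinCutBasis {V : Type*} [Fintype V] (G : SimpleGraph V) (w : G.edgeSet → ℝ) :
    ∃ B, IsMinCutBasis G w B := by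
  obtain ⟨b, -, hspan, hli⟩ :=
    exists_linearIndependent (ZMod 2) (cutSpace G : Set (G.edgeSet → ZMod 2))
  have hne : {B | IsCutBasis G B}.Nonempty := by
    refine ⟨(Set.toFinite b).toFinset, isCutBasis_iff.2 ⟨?_, ?_⟩⟩
    · rw [Set.Finite.coe_toFinset]
      exact hli
    · rw [Set.Finite.coe_toFinset, hspan, Submodule.span_eq]
  obtain ⟨B, hB, hmin⟩ := Set.exists_min_image {B | IsCutBasis G B}
    (fun B => ∑ D ∈ B, weight G w D) (Set.toFinite _) hne
  exact ⟨B, hB, hmin⟩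

/-- A member of a minimum basis that were a sum of lighter cuts could be exchanged for one of
them. -/
theorem IsMinCutBasis.notMem_lightSpan {V : Type*} [Fintype V] {G : SimpleGraph V}
    {w : G.edgeSet → ℝ} {B : Finset (G.edgeSet → ZMod 2)} (hB : IsMinCutBasis G w B)
    {D : G.edgeSet → ZMod 2} (hD : D ∈ B) : D ∉ lightSpan G w (weight G w D) := by
  intro hspan
  have hDB := hB.1.notMem_span_erase hD
  have hex : ∃ U : Set V, weight G w (cutset G U) < weight G w D ∧
      cutset G U ∉ Submodule.span (ZMod 2) (B.erase D : Set (G.edgeSet → ZMod 2)) := by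
    by_contra! hall
    refine hDB (Submodule.span_le.2 ?_ hspan)
    rintro _ ⟨U, rfl, hU⟩
    exact hall U hU
  obtain ⟨U, hlt, hU⟩ := hex
  have h1 := hB.2 _ (hB.1.exchange hD (cutset_mem_cutSpace G U) hU)
  have h2 := sum_weight_exchange w hD hU
  linarith

/-- In a connected graph the cutset determines which pairs of vertices are separated. -/
theorem mem_iff_mem_of_cutset_eq {V : Type*} {G : SimpleGraph V} (hG : G.Connected)
    {U W : Set V} (h : cutset G U = cutset G W) {a b : V} (hW : a ∈ W ↔ b ∈ W) :
    a ∈ U ↔ b ∈ U := by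
  have hadj : ∀ x y, G.Adj x y → ((x ∈ U ↔ x ∈ W) ↔ (y ∈ U ↔ y ∈ W)) := by
    intro x y hxy
    have hxy' : s(x, y) ∈ G.edgeSet := hxy
    have h1 : Crosses G U ⟨s(x, y), hxy'⟩ ↔ Crosses G W ⟨s(x, y), hxy'⟩ := by
      rw [← cutset_eq_one_iff, ← cutset_eq_one_iff, h]
    rw [crosses_mk_iff, crosses_mk_iff] at h1
    tauto
  have hwalk : ∀ x y, G.Walk x y → ((x ∈ U ↔ x ∈ W) ↔ (y ∈ U ↔ y ∈ W)) := by
    intro x y p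
    induction p with
    | nil => rfl
    | cons hxy _ ih => exact (hadj _ _ hxy).trans ih
  obtain ⟨p⟩ := hG.preconnected a b
  have := hwalk a b p
  tauto

/-- The subspace of the cutsets that do not separate `a` from `b`. -/
def nonseparating {V : Type*} (G : SimpleGraph V) (a b : V) :
    Submodule (ZMod 2) (G.edgeSet → ZMod 2) where
  carrier := {D | ∃ U : Set V, D = cutset G U ∧ (a ∈ U ↔ b ∈ U)}
  zero_mem' := ⟨∅, (cutset_empty G).symm, Iff.rfl⟩
  add_mem' := by
    rintro _ _ ⟨U, rfl, hU⟩ ⟨W, rfl, hW⟩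
    refine ⟨symmDiff U W, (cutset_symmDiff G U W).symm, ?_⟩
    rw [Set.mem_symmDiff, Set.mem_symmDiff, hU, hW]
  smul_mem' := by
    rintro c _ ⟨U, rfl, hU⟩
    have hc : c = 0 ∨ c = 1 := by revert c; decide
    rcases hc with rfl | rfl
    · exact ⟨∅, by rw [zero_smul, cutset_empty], Iff.rfl⟩
    · exact ⟨U, by rw [one_smul], hU⟩

/-- Cuts that do not separate `a` from `b` only span such cuts. So a minimum `a,b`-cut, written
in a minimum basis, has a summand separating `a` from `b`, and can replace it. -/
theorem isRelevant_of_isMinCutWeight {V : Type*} [Fintype V] {G : SimpleGraph V}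
    (hG : G.Connected) {w : G.edgeSet → ℝ} {a b : V} {U : Set V} (ha : a ∈ U) (hb : b ∉ U)
    (hmin : IsMinCutWeight G w a b (weight G w (cutset G U))) :
    IsRelevant G w (cutset G U) := by
  obtain ⟨B, hB⟩ := exists_isMinCutBasis G w
  have hUN : cutset G U ∉ nonseparating G a b := by
    rintro ⟨W, hUW, hW⟩
    exact hb ((mem_iff_mem_of_cutset_eq hG hUW hW).1 ha)
  have hex : ∃ d ∈ B, d ∉ nonseparating G a b ∧
      cutset G U ∉ Submodule.span (ZMod 2) (B.erase d : Set (G.edgeSet → ZMod 2)) := by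
    have hspan : cutset G U ∈ Submodule.span (ZMod 2) (B : Set (G.edgeSet → ZMod 2)) :=
      hB.1.2 ▸ cutset_mem_cutSpace G U
    obtain ⟨c, -, hc⟩ := Submodule.mem_span_finset.1 hspan
    have hd : ∃ d ∈ B, c d • d ∉ nonseparating G a b := by
      by_contra! hall
      exact hUN (hc ▸ Submodule.sum_mem _ hall)
    obtain ⟨d, hd, hcd⟩ := hd
    refine ⟨d, hd, fun h => hcd (Submodule.smul_mem _ _ h), fun h => ?_⟩
    have hcd0 : c d ≠ 0 := fun h0 => hcd (by rw [h0, zero_smul]; exact Submodule.zero_mem _)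
    have hrest : ∑ v ∈ B.erase d, c v • v ∈
        Submodule.span (ZMod 2) (B.erase d : Set (G.edgeSet → ZMod 2)) :=
      Submodule.sum_mem _ fun v hv => Submodule.smul_mem _ _ (Submodule.subset_span hv)
    rw [← hc, ← add_sum_erase B _ hd] at h
    exact hB.1.notMem_span_erase hd
      ((Submodule.smul_mem_iff _ hcd0).1 ((Submodule.add_mem_iff_left _ hrest).1 h))
  obtain ⟨d, hd, hsep, hdU⟩ := hex
  have hle : weight G w (cutset G U) ≤ weight G w d := by
    obtain ⟨W, rfl⟩ : d ∈ cutSpace G := hB.1.2 ▸ Submodule.subset_span hd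
    have hW : ¬(a ∈ W ↔ b ∈ W) := fun h => hsep ⟨W, rfl, h⟩
    by_cases haW : a ∈ W
    · exact hmin.2 ⟨W, haW, by tauto, rfl⟩
    · exact hmin.2 ⟨Wᶜ, haW, by simp only [Set.mem_compl_iff]; tauto, by rw [cutset_compl]⟩
  refine ⟨_, ⟨hB.1.exchange hd (cutset_mem_cutSpace G U) hdU, fun B' hB' => ?_⟩,
    mem_insert_self _ _⟩
  have h1 := sum_weight_exchange w hd hdU
  have h2 := hB.2 B' hB'
  linarith

/-! ### Relevant cuts and Gomory–Hu trees -/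

/-- If every tree edge crossing `U` were lighter than `∂U`, then every pair separated by `U` would
be separated by a lighter cut, and `∂U` would be a sum of lighter cuts. -/
theorem IsGomoryHuTree.exists_edge_of_isRelevant {V : Type*} [Fintype V] {G : SimpleGraph V}
    {w : G.edgeSet → ℝ} (hw : ∀ e, 0 ≤ w e) {T : SimpleGraph V} {lam : T.edgeSet → ℝ}
    (hT : IsGomoryHuTree G w T lam) {U : Set V} (hU : IsRelevant G w (cutset G U)) :
    ∃ a b, T.Adj a b ∧ a ∈ U ∧ b ∉ U ∧ IsMinCutWeight G w a b (weight G w (cutset G U)) := by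
  obtain ⟨B, hB, hUB⟩ := hU
  by_contra! hall
  refine hB.notMem_lightSpan hUB (cutset_mem_lightSpan G hw fun x hx y hy => ?_)
  have hxy : x ≠ y := by
    rintro rfl
    exact hy hx
  obtain ⟨p, hp⟩ := (hT.isTree.connected.preconnected x y).exists_isPath
  obtain ⟨d, hd, hdU, hdU'⟩ := p.exists_boundary_dart U hx hy
  obtain ⟨r, ⟨⟨W, hxW, hyW, rfl⟩, -⟩, hr⟩ := hT.path_weight x y hxy p hp
  refine ⟨W, hxW, hyW, (hr.2 ⟨⟨d.edge, d.edge_mem⟩, List.mem_map_of_mem hd, rfl⟩).trans_lt ?_⟩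
  have hd' : (⟨d.edge, d.edge_mem⟩ : T.edgeSet) = ⟨s(d.fst, d.snd), d.adj⟩ := rfl
  rw [hd']
  have hlam := hT.edge_weight d.fst d.snd d.adj
  refine lt_of_le_of_ne (hlam.2 ⟨U, hdU, hdU', rfl⟩) fun h => ?_
  exact hall _ _ d.adj hdU hdU' (h ▸ hlam)

theorem IsMinCutWeight.symm {V : Type*} [Fintype V] {G : SimpleGraph V} {w : G.edgeSet → ℝ}
    {a b : V} {c : ℝ} (h : IsMinCutWeight G w a b c) : IsMinCutWeight G w b a c := by
  obtain ⟨⟨U, ha, hb, rfl⟩, hle⟩ := h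
  refine ⟨⟨Uᶜ, hb, fun h => h ha, by rw [cutset_compl]⟩, ?_⟩
  rintro _ ⟨W, hbW, haW, rfl⟩
  exact hle ⟨Wᶜ, haW, fun h => h hbW, by rw [cutset_compl]⟩

end RelevantCuts

theorem mainTheorem2 {V : Type*} [Fintype V]
    (G : SimpleGraph V) (hG : G.Connected)
    (w : G.edgeSet → ℝ) (hw : ∀ e, 0 ≤ w e)
    (T : SimpleGraph V) (lam : T.edgeSet → ℝ)
    (hT : RelevantCuts.IsGomoryHuTree G w T lam)
    (src tgt : T.edgeSet → V) (hst : ∀ e : T.edgeSet, (e : Sym2 V) = s(src e, tgt e))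
    (f : T.edgeSet → V → V → ℝ)
    (hf : ∀ e : T.edgeSet, RelevantCuts.IsMaxFlow G w (src e) (tgt e) (f e)) :
    (∀ D ∈ RelevantCuts.cutSpace G,
      RelevantCuts.IsRelevant G w D ↔
        ∃ e : T.edgeSet, RelevantCuts.IsRepresented G w (src e) (tgt e) (f e) D) ∧
    Nat.card T.edgeSet + 1 = Nat.card V := by
  classical
  have hne : ∀ e : T.edgeSet, src e ≠ tgt e := fun e => by
    have h : s(src e, tgt e) ∈ T.edgeSet := hst e ▸ e.2
    exact T.ne_of_adj h
  refine ⟨?_, ?_⟩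
  · rintro _ ⟨U, rfl⟩
    constructor
    · intro hU
      obtain ⟨a, b, hab, ha, hb, hmin⟩ := hT.exists_edge_of_isRelevant hw hU
      refine ⟨⟨s(a, b), hab⟩, (RelevantCuts.isRepresented_iff (hf _) (hne _) _).2 ?_⟩
      rcases Sym2.eq_iff.1 (hst ⟨s(a, b), hab⟩) with ⟨h1, h2⟩ | ⟨h1, h2⟩
      · rw [← h1, ← h2]
        exact ⟨U, rfl, ha, hb, hmin⟩
      · rw [← h1, ← h2]
        refine ⟨Uᶜ, (RelevantCuts.cutset_compl G U).symm, hb, fun h => h ha, ?_⟩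
        rw [RelevantCuts.cutset_compl]
        exact hmin.symm
    · rintro ⟨e, he⟩
      obtain ⟨W, hW, ha, hb, hmin⟩ := (RelevantCuts.isRepresented_iff (hf e) (hne e) _).1 he
      rw [hW]
      exact RelevantCuts.isRelevant_of_isMinCutWeight hG ha hb hmin
  · rw [Nat.card_eq_fintype_card, Nat.card_eq_fintype_card, ← hT.isTree.card_edgeFinset,
      SimpleGraph.edgeFinset_card]
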